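/- Let $X$ be a euclidean neighbourhood retract (ENR), i.e. a space that embeds in some $\mathbb{R}^N$ as a retract of an open neighbourhood of its image, and let $n\ge 1$. Then $$\operatorname{genus}(\varepsilon_n)\;\le\;\operatorname{TC}^{\Sigma}_n(X)\;\le\;\operatorname{genus}(\varepsilon_n)+\cdots+\operatorname{genus}(\varepsilon_2)+n-1 ,$$ as an inequality in $\{-1,0,1,2,\dots\}\cup\{\infty\}$ and its sums in $\mathbb{Z}\cup\{\infty\}$ (for $n=1$ the sum of genera is empty, hence $0$). Here the notation is as follows. * $J_n$ is the wedge of $n$ copies of $[0,1]$ with base point $0$, $X^{J_n}$ is the space of continuous maps $J_n\to X$ with the compact-open topology, and $e_n:X^{J_n}\to X^n$, $e_n(\gamma)=(\gamma(1_1),\dots,\gamma(1_n))$, where $1_i$ is the point $1$ of the $i$-th interval. The symmetric group $\Sigma_n$ acts on $X^n$ by permuting coordinates and on $X^{J_n}$ by permuting paths. * $\operatorname{TC}^{\Sigma}_n(X)$ is the least integer $k\ge 0$ such that $X^n=A_0\cup\dots\cup A_k$, where each $A_i$ is open, satisfies $\sigma A_i=A_i$ for all $\sigma\in\Sigma_n$,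 and admits a continuous $\Sigma_n$-equivariant map $s_i:A_i\to X^{J_n}$ with $e_n(s_i(a))=a$ for all $a\in A_i$; it is $\infty$ if there is no such $k$. * For $i\ge1$, $C_i(X)\subset X^i$ is the space of $i$-tuples of pairwise distinct points of $X$, $B_i(X)=C_i(X)/\Sigma_i$, $Y_i(X)=e_i^{-1}(C_i(X))/\Sigma_i$ (orbit spaces, with the quotient topology), and $\varepsilon_i:Y_i(X)\to B_i(X)$ is the fibration induced by $e_i$. * The (normalized) Schwarz genus $\operatorname{genus}(p)$ of a fibration $p:E\to B$ is the least integer $k\ge 0$ such that $B$ has an open covering $U_0,\dots,U_k$ with a continuous section of $p$ over each $U_i$; it is $\infty$ if there is no such $k$, and $-1$ if $E=\varnothing=B$. -/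

import Mathlib

namespace HigherTC

/- ### Euclidean neighbourhood retracts -/

/-- `X` is a euclidean neighbourhood retract: it embeds in some `ℝ^N` as a retract of an open
neighbourhood of its image. The retraction `U → f(X)` is recorded after identifying `f(X)`
with `X`. -/
def IsENR (X : Type*) [TopologicalSpace X] : Prop :=
  ∃ (N : ℕ) (f : X → EuclideanSpace ℝ (Fin N)) (U : Set (EuclideanSpace ℝ (Fin N))),
    Topology.IsEmbedding f ∧ IsOpen U ∧ Set.range f ⊆ U ∧
      ∃ r : C(U, X), ∀ (x : X) (hx : f x ∈ U), r ⟨f x, hx⟩ = x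

/- ### The Schwarz genus -/

open Classical in
/-- The least natural number satisfying `P`, and `∞` if there is none. -/
noncomputable def leastOrTop (P : ℕ → Prop) : WithTop ℤ :=
  if h : ∃ k, P k then ((Nat.find h : ℤ) : WithTop ℤ) else ⊤

/-- `p` admits a continuous section over the subset `U` of its base. -/
def HasSectionOver {E B : Type*} [TopologicalSpace E] [TopologicalSpace B]
    (p : E → B) (U : Set B) : Prop :=
  ∃ s : C(U, E), ∀ b : U, p (s b) = b

open Classical in
/-- The (normalized) Schwarz genus of a fibration `p : E → B`: the least `k` such that `B` has an
open covering `U₀, …, U_k` with a continuous section of `p` over each `U_i`. It is `∞` if there is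
no such `k`, and `-1` if `E = ∅ = B`. -/
noncomputable def schwarzGenus {E B : Type*} [TopologicalSpace E] [TopologicalSpace B]
    (p : E → B) : WithTop ℤ :=
  if IsEmpty E ∧ IsEmpty B then ((-1 : ℤ) : WithTop ℤ)
  else leastOrTop fun k =>
    ∃ U : Fin (k + 1) → Set B, (⋃ i, U i) = Set.univ ∧
      ∀ i, IsOpen (U i) ∧ HasSectionOver p (U i)

/- ### The wedge of `n` intervals -/

/-- The relation on `n` disjoint copies of `[0,1]` which identifies all the points `0`. -/
def wedgeSetoid (n : ℕ) : Setoid (Fin n × unitInterval) where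
  r p q := p = q ∨ (p.2 = 0 ∧ q.2 = 0)
  iseqv :=
    { refl := fun _ => Or.inl rfl
      symm := by
        rintro p q (h | ⟨h₁, h₂⟩)
        · exact Or.inl h.symm
        · exact Or.inr ⟨h₂, h₁⟩
      trans := by
        rintro p q r (rfl | ⟨h₁, h₂⟩) (rfl | ⟨h₃, h₄⟩)
        · exact Or.inl rfl
        · exact Or.inr ⟨h₃, h₄⟩
        · exact Or.inr ⟨h₁, h₂⟩
        · exact Or.inr ⟨h₁, h₄⟩ }

/-- `J_n`, the wedge of `n` copies of `[0,1]`, each with base point `0` (for `n ≥ 1`), with the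
quotient topology. -/
abbrev IntervalWedge (n : ℕ) : Type := Quotient (wedgeSetoid n)

/-- The point `t` of the `i`-th interval of `J_n`. -/
def IntervalWedge.mk {n : ℕ} (i : Fin n) (t : unitInterval) : IntervalWedge n :=
  Quotient.mk (wedgeSetoid n) (i, t)

/-- The self-map of `J_n` that moves the `i`-th interval identically onto the `σ(i)`-th one. -/
def IntervalWedge.perm {n : ℕ} (σ : Equiv.Perm (Fin n)) : C(IntervalWedge n, IntervalWedge n) where
  toFun := Quotient.map (fun p : Fin n × unitInterval => (σ p.1, p.2)) (by
    rintro p q (rfl | h)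
    · exact Or.inl rfl
    · exact Or.inr h)
  continuous_toFun := by
    refine Continuous.quotient_map' ?_ _
    exact (continuous_of_discreteTopology.comp continuous_fst).prodMk continuous_snd

@[simp] theorem IntervalWedge.perm_mk {n : ℕ} (σ : Equiv.Perm (Fin n)) (i : Fin n) (t : unitInterval) :
    IntervalWedge.perm σ (IntervalWedge.mk i t) = IntervalWedge.mk (σ i) t := rfl

/- ### Multipaths and the evaluation map `e_n` -/

/-- `X^{J_n}`, with the compact-open topology. -/
abbrev MultiPath (n : ℕ) (X : Type*) [TopologicalSpace X] := C(IntervalWedge n, X)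

/-- `e_n : X^{J_n} → X^n`, `e_n(γ) = (γ(1_1), …, γ(1_n))`. -/
def endpoints {n : ℕ} {X : Type*} [TopologicalSpace X] (γ : MultiPath n X) : Fin n → X :=
  fun i => γ (IntervalWedge.mk i 1)

/-- The action of `Σ_n` on `X^n` by permutation of coordinates: `(σ x)_i = x_{σ⁻¹ i}`. -/
def permTuple {n : ℕ} {X : Type*} (σ : Equiv.Perm (Fin n)) (x : Fin n → X) : Fin n → X :=
  fun i => x (σ⁻¹ i)

/-- The action of `Σ_n` on `X^{J_n}` by permutation of paths: `(σ γ)_i = γ_{σ⁻¹ i}`. -/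
def permPaths {n : ℕ} {X : Type*} [TopologicalSpace X] (σ : Equiv.Perm (Fin n))
    (γ : MultiPath n X) : MultiPath n X :=
  γ.comp (IntervalWedge.perm σ⁻¹)

theorem endpoints_permPaths {n : ℕ} {X : Type*} [TopologicalSpace X] (σ : Equiv.Perm (Fin n))
    (γ : MultiPath n X) : endpoints (permPaths σ γ) = permTuple σ (endpoints γ) := rfl

/- ### The symmetric higher topological complexity -/

/-- `A ⊆ X^n` is symmetric if `σ A = A` for all `σ ∈ Σ_n`. -/
def IsSymmetric {n : ℕ} {X : Type*} (A : Set (Fin n → X)) : Prop :=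
  ∀ σ : Equiv.Perm (Fin n), permTuple σ '' A = A

/-- `e_n` admits a continuous `Σ_n`-equivariant section over the (symmetric) set `A`. -/
def HasEquivariantSectionOver {n : ℕ} {X : Type*} [TopologicalSpace X]
    (A : Set (Fin n → X)) : Prop :=
  ∃ s : C(A, MultiPath n X), (∀ a : A, endpoints (s a) = a) ∧
    ∀ (σ : Equiv.Perm (Fin n)) (a : A) (h : permTuple σ (a : Fin n → X) ∈ A),
      s ⟨permTuple σ a, h⟩ = permPaths σ (s a)

/-- `TC^Σ_n(X)`: the least `k` such that `X^n = A₀ ∪ ⋯ ∪ A_k` with each `A_i` open, symmetric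
and endowed with a continuous equivariant section of `e_n`; it is `∞` if there is no such `k`. -/
noncomputable def tcSigma (n : ℕ) (X : Type*) [TopologicalSpace X] : WithTop ℤ :=
  leastOrTop fun k =>
    ∃ A : Fin (k + 1) → Set (Fin n → X), (⋃ i, A i) = Set.univ ∧
      ∀ i, IsOpen (A i) ∧ IsSymmetric (A i) ∧ HasEquivariantSectionOver (A i)

/- ### Configuration spaces and the map `ε_n` -/

/-- `C_n(X)`, the space of `n` ordered distinct points of `X`. -/
abbrev ConfigSpace (n : ℕ) (X : Type*) := {x : Fin n → X // Function.Injective x}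

/-- `e_n⁻¹(C_n(X))`, the space of multipaths with pairwise distinct end points. -/
abbrev ConfigMultiPath (n : ℕ) (X : Type*) [TopologicalSpace X] :=
  {γ : MultiPath n X // Function.Injective (endpoints γ)}

instance (n : ℕ) (X : Type*) : MulAction (Equiv.Perm (Fin n)) (ConfigSpace n X) where
  smul σ x := ⟨permTuple σ x.1, x.2.comp (σ⁻¹).injective⟩
  one_smul _ := rfl
  mul_smul σ τ x := by
    apply Subtype.ext
    funext i
    exact congrArg x.1 (by rw [mul_inv_rev]; rfl)

instance (n : ℕ) (X : Type*) [TopologicalSpace X] :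
    MulAction (Equiv.Perm (Fin n)) (ConfigMultiPath n X) where
  smul σ γ := ⟨permPaths σ γ.1, γ.2.comp (σ⁻¹).injective⟩
  one_smul γ := by
    apply Subtype.ext
    ext p
    induction p using Quotient.inductionOn with
    | h p => rfl
  mul_smul σ τ γ := by
    apply Subtype.ext
    ext p
    induction p using Quotient.inductionOn with
    | h p => exact congrArg γ.1 (congrArg (fun i => IntervalWedge.mk i p.2)
        (by rw [mul_inv_rev]; rfl))

/-- `B_n(X) = C_n(X) / Σ_n`, with the quotient topology. -/
abbrev UnorderedConfigSpace (n : ℕ) (X : Type*) :=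
  Quotient (MulAction.orbitRel (Equiv.Perm (Fin n)) (ConfigSpace n X))

/-- `Y_n(X) = e_n⁻¹(C_n(X)) / Σ_n`, with the quotient topology. -/
abbrev UnorderedMultiPath (n : ℕ) (X : Type*) [TopologicalSpace X] :=
  Quotient (MulAction.orbitRel (Equiv.Perm (Fin n)) (ConfigMultiPath n X))

/-- `ε_n : Y_n(X) → B_n(X)`, the fibration induced by `e_n` on orbit spaces. -/
def epsilon (n : ℕ) (X : Type*) [TopologicalSpace X] :
    UnorderedMultiPath n X → UnorderedConfigSpace n X :=
  Quotient.map (fun γ : ConfigMultiPath n X => (⟨endpoints γ.1, γ.2⟩ : ConfigSpace n X)) (by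
    rintro _ γ ⟨σ, rfl⟩
    exact ⟨σ, rfl⟩)

end HigherTC

namespace HigherTC

open Topology

variable {X : Type*} [TopologicalSpace X]

/-! ### The wedge of intervals -/

/-! Lower bound: an equivariant section over an open set of `n`-tuples, restricted to
configurations, descends to the orbit space (`HasEquivariantSectionOver.hasSectionOver`), so a
covering of `X^n` yields one of `B_n(X)` of the same size.

Upper bound: stratify `X^n` by the number `i` of distinct entries. A section of `ε_i` over an open
set lifts to an equivariant section over ordered configurations because `Σ_i` acts freely
(`HasSectionOver.hasEquivariantSectionOver`). Repeating paths transports it to `n`-tuples with `i`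
distinct entries (`HasEquivariantSectionOver.spread`), and the ENR property thickens the result to
an open symmetric set (`exists_open_extension`). The stratum `i ≥ 2` needs `genus(ε_i) + 1` sets;
the diagonal `i = 1` needs one, via constant paths. The latter is absorbed by the normalization, and
the `+ 1` for each of `2, …, n` gives the term `n - 1`. -/

theorem IntervalWedge.mk_one_injective {n : ℕ} :
    Function.Injective fun i : Fin n => IntervalWedge.mk i 1 := by
  intro i j h
  rcases Quotient.exact h with h | h
  · exact congrArg Prod.fst h
  · exact absurd h.1 one_ne_zero

/-- The embedding of the wedge as the union of the coordinate axes of the cube. -/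
def IntervalWedge.axes {n : ℕ} : IntervalWedge n → Fin n → unitInterval :=
  Quotient.lift (fun p => Pi.single p.1 p.2) (by
    rintro p q (rfl | ⟨h₁, h₂⟩)
    · rfl
    · simp [h₁, h₂])

/-- Used to make the wedge metrizable, so that its products with subsets of `X^n` are normal and
Tietze's theorem applies. -/
theorem IntervalWedge.isClosedEmbedding_axes {n : ℕ} :
    IsClosedEmbedding (IntervalWedge.axes (n := n)) := by
  apply Continuous.isClosedEmbedding
  · refine Continuous.quotient_lift ?_ _
    rw [continuous_prod_of_discrete_left]
    intro i
    exact continuous_single (A := fun _ : Fin n => unitInterval) i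
  · intro p q
    induction p using Quotient.inductionOn with | h p => ?_
    induction q using Quotient.inductionOn with | h q => ?_
    obtain ⟨i, t⟩ := p
    obtain ⟨j, u⟩ := q
    intro h
    apply Quotient.sound
    change (Pi.single i t : Fin n → unitInterval) = Pi.single j u at h
    by_cases hij : i = j
    · subst hij
      left
      rw [Pi.single_injective _ h]
    · right
      constructor
      · simpa [hij] using congrFun h i
      · simpa [Ne.symm hij] using (congrFun h j).symm

instance (n : ℕ) : TopologicalSpace.MetrizableSpace (IntervalWedge n) :=
  IntervalWedge.isClosedEmbedding_axes.isEmbedding.metrizableSpace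

/-- The map of wedges which moves the `i`-th interval identically onto the `κ(i)`-th one. -/
def IntervalWedge.map {n m : ℕ} (κ : Fin n → Fin m) : C(IntervalWedge n, IntervalWedge m) where
  toFun := Quotient.map (fun p : Fin n × unitInterval => (κ p.1, p.2)) (by
    rintro p q (rfl | h)
    · exact Or.inl rfl
    · exact Or.inr h)
  continuous_toFun := by
    refine Continuous.quotient_map' ?_ _
    exact (continuous_of_discreteTopology.comp continuous_fst).prodMk continuous_snd

theorem endpoints_comp_map {n m : ℕ} (κ : Fin n → Fin m) (γ : MultiPath m X) :
    endpoints (γ.comp (IntervalWedge.map κ)) = endpoints γ ∘ κ := rfl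

theorem comp_map_comp_map {n m k : ℕ} (κ : Fin n → Fin m) (μ : Fin m → Fin k)
    (γ : MultiPath k X) :
    (γ.comp (IntervalWedge.map μ)).comp (IntervalWedge.map κ) =
      γ.comp (IntervalWedge.map (μ ∘ κ)) := by
  ext p
  induction p using Quotient.inductionOn with | h p => rfl

theorem permPaths_eq_comp_map {n : ℕ} (σ : Equiv.Perm (Fin n)) (γ : MultiPath n X) :
    permPaths σ γ = γ.comp (IntervalWedge.map (σ⁻¹ : Equiv.Perm (Fin n))) := rfl

theorem permTuple_eq_comp {n : ℕ} {X : Type*} (σ : Equiv.Perm (Fin n)) (x : Fin n → X) :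
    permTuple σ x = x ∘ (σ⁻¹ : Equiv.Perm (Fin n)) := rfl

theorem continuous_endpoints {n : ℕ} : Continuous (endpoints : MultiPath n X → Fin n → X) :=
  continuous_pi fun _ => continuous_eval_const _

theorem continuous_permTuple {n : ℕ} (σ : Equiv.Perm (Fin n)) :
    Continuous (permTuple σ : (Fin n → X) → Fin n → X) :=
  continuous_pi fun _ => continuous_apply _

/-! ### Symmetric sets -/

theorem permTuple_mul {n : ℕ} {X : Type*} (σ τ : Equiv.Perm (Fin n)) (x : Fin n → X) :
    permTuple (σ * τ) x = permTuple σ (permTuple τ x) := by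
  funext i
  simp [permTuple, mul_inv_rev]

theorem permTuple_one {n : ℕ} {X : Type*} (x : Fin n → X) : permTuple 1 x = x := rfl

theorem isSymmetric_iff {n : ℕ} {X : Type*} {A : Set (Fin n → X)} :
    IsSymmetric A ↔ ∀ (σ : Equiv.Perm (Fin n)), ∀ x ∈ A, permTuple σ x ∈ A := by
  constructor
  · intro h σ x hx
    rw [← h σ]
    exact ⟨x, hx, rfl⟩
  · intro h σ
    apply Set.Subset.antisymm
    · rintro _ ⟨x, hx, rfl⟩
      exact h σ x hx
    · intro x hx
      exact ⟨_, h σ⁻¹ x hx, by rw [← permTuple_mul, mul_inv_cancel, permTuple_one]⟩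

theorem IsSymmetric.comp_mem {n : ℕ} {X : Type*} {A : Set (Fin n → X)} (hA : IsSymmetric A)
    {x : Fin n → X} (hx : x ∈ A) (σ : Equiv.Perm (Fin n)) : x ∘ σ ∈ A := by
  simpa [permTuple_eq_comp] using isSymmetric_iff.1 hA σ⁻¹ x hx

theorem isOpen_setOf_injective [T2Space X] {n : ℕ} :
    IsOpen {x : Fin n → X | Function.Injective x} := by
  have : {x : Fin n → X | Function.Injective x} = ⋂ (i) (j) (_ : i ≠ j), {x | x i ≠ x j} := by
    ext x
    simp only [Set.mem_ofPred_eq, Set.mem_iInter]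
    exact ⟨fun h i j hij => h.ne hij, fun h i j hij => by_contra fun hne => h i j hne hij⟩
  rw [this]
  exact isOpen_iInter_of_finite fun i => isOpen_iInter_of_finite fun j =>
    isOpen_iInter_of_finite fun _ => isOpen_ne_fun (continuous_apply i) (continuous_apply j)

/-! ### Extension of equivariant sections to open neighbourhoods -/

theorem IsENR.metrizableSpace (hX : IsENR X) : TopologicalSpace.MetrizableSpace X := by
  obtain ⟨N, f, U, hf, -⟩ := hX
  exact hf.metrizableSpace

/-- Over a relatively closed subset `Z` of an open set `O`, an equivariant section has an extension
to `O` as a family of multipaths in the ambient euclidean space. -/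
theorem exists_euclidean_extension [TopologicalSpace.MetrizableSpace X] {N n : ℕ}
    {f : X → EuclideanSpace ℝ (Fin N)} (hf : Continuous f) {Z O : Set (Fin n → X)}
    (hZ : IsClosed {x : O | x.1 ∈ Z}) (s : C(Z, MultiPath n X))
    (hs : ∀ a : Z, endpoints (s a) = a) :
    ∃ F : C(O × IntervalWedge n, EuclideanSpace ℝ (Fin N)),
      (∀ (x : O) (h : x.1 ∈ Z) p, F (x, p) = f (s ⟨x, h⟩ p)) ∧
      ∀ (x : O) j, F (x, IntervalWedge.mk j 1) = f (x.1 j) := by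
  classical
  -- Only the values over `Z` and at the points `1_j` matter; the final `0` is a dummy.
  let G : O × IntervalWedge n → EuclideanSpace ℝ (Fin N) := fun p =>
    if h : p.1.1 ∈ Z then f (s ⟨p.1, h⟩ p.2)
    else if h : ∃ j, p.2 = IntervalWedge.mk j 1 then f (p.1.1 h.choose) else 0
  have hG₁ : ∀ (x : O) (h : x.1 ∈ Z) p, G (x, p) = f (s ⟨x, h⟩ p) := fun x h p => dif_pos h
  have hG₂ : ∀ (x : O) j, G (x, IntervalWedge.mk j 1) = f (x.1 j) := by
    intro x j
    by_cases h : x.1 ∈ Z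
    · rw [hG₁ x h]
      exact congrArg f (congrFun (hs ⟨x, h⟩) j)
    · have hj : ∃ k : Fin n, IntervalWedge.mk j 1 = IntervalWedge.mk k 1 := ⟨j, rfl⟩
      have : hj.choose = j := (IntervalWedge.mk_one_injective hj.choose_spec).symm
      simp only [G, dif_neg h, dif_pos hj, this]
  -- Prescribing the end points on all of `O`, not just over `Z`, keeps the extension a section
  -- after retraction.
  let K : Option (Fin n) → Set (O × IntervalWedge n) := fun o =>
    o.elim {p | p.1.1 ∈ Z} fun j => {p | p.2 = IntervalWedge.mk j 1}
  have hK : ∀ o, IsClosed (K o) := by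
    rintro (_ | j)
    · exact hZ.preimage continuous_fst
    · exact isClosed_eq continuous_snd continuous_const
  have hcont : ContinuousOn G (⋃ o, K o) := by
    refine (locallyFinite_of_finite K).continuousOn_iUnion hK ?_
    rintro (_ | j)
    · rw [continuousOn_iff_continuous_domRestrict]
      have : (K none).domRestrict G = fun p => f (s ⟨p.1.1.1, p.2⟩ p.1.2) := by
        funext p
        exact hG₁ _ p.2 _
      rw [this]
      have hpair : Continuous fun p : K none =>
          ((⟨p.1.1.1, p.2⟩, p.1.2) : Z × IntervalWedge n) := by
        refine Continuous.prodMk (Continuous.subtype_mk ?_ _) ?_ <;> fun_prop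
      exact hf.comp (s.uncurry.continuous.comp hpair)
    · have : Set.EqOn G (fun p => f (p.1.1 j)) (K (some j)) := by
        rintro ⟨x, p⟩ (rfl : p = _)
        exact hG₂ x j
      refine ContinuousOn.congr (Continuous.continuousOn ?_) this
      exact hf.comp ((continuous_apply j).comp (continuous_subtype_val.comp continuous_fst))
  let := TopologicalSpace.metrizableSpaceMetric (O × IntervalWedge n)
  obtain ⟨F, hF⟩ := ContinuousMap.exists_restrict_eq (isClosed_iUnion_of_finite hK)
    ⟨_, continuousOn_iff_continuous_domRestrict.1 hcont⟩
  have hFG : ∀ p ∈ ⋃ o, K o, F p = G p := fun p hp => DFunLike.congr_fun hF ⟨p, hp⟩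
  refine ⟨F, fun x h p => ?_, fun x j => ?_⟩
  · rw [hFG _ (Set.mem_iUnion.2 ⟨none, h⟩), hG₁ x h]
  · rw [hFG _ (Set.mem_iUnion.2 ⟨some j, rfl⟩), hG₂]

/-- Average the extension over `Σ_n`. Over `Z` and at the end points all summands already agree with
the prescribed value, so averaging preserves both conditions. -/
theorem exists_invariant_euclidean_extension [TopologicalSpace.MetrizableSpace X] {N n : ℕ}
    {f : X → EuclideanSpace ℝ (Fin N)} (hf : Continuous f) {Z O : Set (Fin n → X)}
    (hZsymm : IsSymmetric Z) (hOsymm : IsSymmetric O)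
    (hZ : IsClosed {x : O | x.1 ∈ Z}) (s : C(Z, MultiPath n X))
    (hs : ∀ a : Z, endpoints (s a) = a)
    (hequiv : ∀ (σ : Equiv.Perm (Fin n)) (a : Z) (h : permTuple σ (a : Fin n → X) ∈ Z),
      s ⟨permTuple σ a, h⟩ = permPaths σ (s a)) :
    ∃ F : C(O × IntervalWedge n, EuclideanSpace ℝ (Fin N)),
      (∀ (x : O) (h : x.1 ∈ Z) p, F (x, p) = f (s ⟨x, h⟩ p)) ∧
      (∀ (x : O) j, F (x, IntervalWedge.mk j 1) = f (x.1 j)) ∧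
      ∀ (σ : Equiv.Perm (Fin n)) (x : O) (h : permTuple σ x.1 ∈ O) p,
        F (⟨permTuple σ x.1, h⟩, p) = F (x, IntervalWedge.perm σ⁻¹ p) := by
  obtain ⟨F, hF₁, hF₂⟩ := exists_euclidean_extension hf hZ s hs
  let act : Equiv.Perm (Fin n) → O → O := fun σ x =>
    ⟨permTuple σ x.1, isSymmetric_iff.1 hOsymm σ x.1 x.2⟩
  have hact : ∀ σ, Continuous (act σ) := fun σ =>
    ((continuous_permTuple σ).comp continuous_subtype_val).subtype_mk _
  let c : ℝ := (Fintype.card (Equiv.Perm (Fin n)) : ℝ)⁻¹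
  have hc : ∀ v : EuclideanSpace ℝ (Fin N), c • ∑ _σ : Equiv.Perm (Fin n), v = v := by
    intro v
    rw [Finset.sum_const, Finset.card_univ, ← Nat.cast_smul_eq_nsmul ℝ, smul_smul,
      inv_mul_cancel₀ (Nat.cast_ne_zero.2 Fintype.card_ne_zero), one_smul]
  refine ⟨⟨fun q => c • ∑ σ, F (act σ q.1, IntervalWedge.perm σ q.2), ?_⟩, ?_, ?_, ?_⟩
  · refine Continuous.const_smul (continuous_finsetSum _ fun σ _ => F.continuous.comp ?_) c
    exact ((hact σ).comp continuous_fst).prodMk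
      ((IntervalWedge.perm σ).continuous.comp continuous_snd)
  · intro x h p
    rw [← hc (f (s ⟨x, h⟩ p))]
    change c • ∑ σ, F (act σ x, IntervalWedge.perm σ p) = _
    congr 1
    refine Finset.sum_congr rfl fun σ _ => ?_
    have hσ : (act σ x).1 ∈ Z := isSymmetric_iff.1 hZsymm σ x.1 h
    rw [hF₁ _ hσ, hequiv σ ⟨x, h⟩ hσ]
    congr 1
    induction p using Quotient.inductionOn with | h p => ?_
    change s ⟨x, h⟩ (IntervalWedge.mk (σ⁻¹ (σ p.1)) p.2) = _
    rw [show σ⁻¹ (σ p.1) = p.1 from σ.symm_apply_apply p.1]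
    rfl
  · intro x j
    rw [← hc (f (x.1 j))]
    change c • ∑ σ, F (act σ x, IntervalWedge.mk (σ j) 1) = _
    congr 1
    refine Finset.sum_congr rfl fun σ _ => ?_
    rw [hF₂]
    simp [act, permTuple]
  · intro τ x h p
    change c • ∑ σ, F (act σ ⟨permTuple τ x.1, h⟩, IntervalWedge.perm σ p) =
      c • ∑ σ, F (act σ x, IntervalWedge.perm σ (IntervalWedge.perm τ⁻¹ p))
    congr 1
    refine Fintype.sum_equiv (Equiv.mulRight τ) _ _ fun σ => ?_
    refine congrArg F (Prod.ext (Subtype.ext (permTuple_mul σ τ x.1).symm) ?_)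
    induction p using Quotient.inductionOn with | h p => ?_
    change IntervalWedge.mk (σ p.1) p.2 = IntervalWedge.mk ((σ * τ) (τ⁻¹ p.1)) p.2
    simp

/-- Retract the invariant euclidean extension to `X` wherever a whole multipath stays in `U`. -/
theorem exists_open_extension (hX : IsENR X) {n : ℕ} {Z O : Set (Fin n → X)}
    (hZO : Z ⊆ O) (hO : IsOpen O) (hZsymm : IsSymmetric Z) (hOsymm : IsSymmetric O)
    (hZ : IsClosed {x : O | x.1 ∈ Z}) (h : HasEquivariantSectionOver Z) :
    ∃ A : Set (Fin n → X), Z ⊆ A ∧ IsOpen A ∧ IsSymmetric A ∧ HasEquivariantSectionOver A := by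
  have := hX.metrizableSpace
  obtain ⟨N, f, U, hf, hU, hfU, r, hr⟩ := hX
  obtain ⟨s, hs, hequiv⟩ := h
  obtain ⟨F, hF₁, hF₂, hF₃⟩ :=
    exists_invariant_euclidean_extension hf.continuous hZsymm hOsymm hZ s hs hequiv
  let A' : Set O := {x | ∀ p, F (x, p) ∈ U}
  have hA' : IsOpen A' := by
    -- Tube lemma: projection along the compact wedge is a closed map.
    have : A' = (Prod.fst '' (F ⁻¹' U)ᶜ)ᶜ := by
      ext x
      simp [A']
    rw [this]
    exact (isClosedMap_fst_of_compactSpace _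
      (hU.preimage F.continuous).isClosed_compl).isOpen_compl
  have hAO : ∀ x : (Subtype.val '' A' : Set (Fin n → X)), x.1 ∈ O := by
    rintro ⟨_, x, -, rfl⟩
    exact x.2
  have hAU : ∀ x : (Subtype.val '' A' : Set (Fin n → X)), ∀ p, F (⟨x.1, hAO x⟩, p) ∈ U := by
    rintro ⟨_, x, hx, rfl⟩
    exact hx
  let S : C((Subtype.val '' A' : Set (Fin n → X)) × IntervalWedge n, X) :=
    ⟨fun q => r ⟨F (⟨q.1.1, hAO q.1⟩, q.2), hAU q.1 q.2⟩, by
      refine r.continuous.comp (Continuous.subtype_mk (F.continuous.comp ?_) _)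
      exact ((continuous_subtype_val.comp continuous_fst).subtype_mk _).prodMk continuous_snd⟩
  refine ⟨Subtype.val '' A', ?_, hO.isOpenMap_subtype_val _ hA', ?_, S.curry, ?_, ?_⟩
  · intro x hx
    refine ⟨⟨x, hZO hx⟩, fun p => ?_, rfl⟩
    rw [hF₁ ⟨x, hZO hx⟩ hx]
    exact hfU ⟨_, rfl⟩
  · rw [isSymmetric_iff]
    rintro σ _ ⟨x, hx, rfl⟩
    refine ⟨⟨_, isSymmetric_iff.1 hOsymm σ x.1 x.2⟩, fun p => ?_, rfl⟩
    rw [hF₃]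
    exact hx _
  · intro a
    funext j
    change r ⟨F (⟨a.1, hAO a⟩, IntervalWedge.mk j 1), _⟩ = a.1 j
    simp only [hF₂]
    exact hr _ _
  · intro σ a h
    ext p
    change r ⟨F (⟨permTuple σ a.1, _⟩, p), _⟩ = r ⟨F (⟨a.1, hAO a⟩, IntervalWedge.perm σ⁻¹ p), _⟩
    congr 2
    exact hF₃ σ ⟨a.1, hAO a⟩ _ p

/-! ### Spreading sections from configurations to strata of `X^n` -/

/-- The `n`-tuples obtained from the `m`-tuples in `V` by repeating coordinates. -/
def spread {X : Type*} {m : ℕ} (n : ℕ) (V : Set (Fin m → X)) : Set (Fin n → X) :=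
  {x | ∃ y ∈ V, ∃ κ : Fin n → Fin m, Function.Surjective κ ∧ x = y ∘ κ}

/-- The `n`-tuples which contain a tuple of `V` as a subfamily. -/
def containing {X : Type*} {m : ℕ} (n : ℕ) (V : Set (Fin m → X)) : Set (Fin n → X) :=
  {x | ∃ J : Fin m → Fin n, x ∘ J ∈ V}

theorem isSymmetric_spread {X : Type*} {m n : ℕ} (V : Set (Fin m → X)) :
    IsSymmetric (spread n V) := by
  rw [isSymmetric_iff]
  rintro σ _ ⟨y, hy, κ, hκ, rfl⟩
  exact ⟨y, hy, κ ∘ (σ⁻¹ : Equiv.Perm (Fin n)), hκ.comp (σ⁻¹).surjective, rfl⟩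

theorem isSymmetric_containing {X : Type*} {m n : ℕ} (V : Set (Fin m → X)) :
    IsSymmetric (containing n V) := by
  rw [isSymmetric_iff]
  rintro σ x ⟨J, hJ⟩
  refine ⟨σ ∘ J, ?_⟩
  convert hJ using 1
  funext i
  simp [permTuple]

theorem isOpen_containing {m n : ℕ} {V : Set (Fin m → X)} (hV : IsOpen V) :
    IsOpen (containing n V) := by
  have : containing n V = ⋃ J : Fin m → Fin n, (fun x => x ∘ J) ⁻¹' V := by
    ext x
    simp [containing]
  rw [this]
  exact isOpen_iUnion fun J => hV.preimage (by fun_prop)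

theorem spread_subset_containing {X : Type*} {m n : ℕ} (V : Set (Fin m → X)) :
    spread n V ⊆ containing n V := by
  rintro _ ⟨y, hy, κ, hκ, rfl⟩
  obtain ⟨J, hJ⟩ := hκ.hasRightInverse
  exact ⟨J, by rwa [Function.comp_assoc, hJ.comp_eq_id, Function.comp_id]⟩

/-- If `x` is a tuple with at most `m` distinct entries, sorted by `κ`, then it is recovered from
any `m` distinct ones among them. -/
theorem eq_comp_of_factors {X : Type*} {m n : ℕ} {V : Set (Fin m → X)} (hsymm : IsSymmetric V)
    (hinj : ∀ y ∈ V, Function.Injective y) {x : Fin n → X} {J : Fin m → Fin n}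
    (hJ : x ∘ J ∈ V) {κ : Fin n → Fin m} (hκ : ∀ a b, κ a = κ b → x a = x b) :
    ∃ y ∈ V, Function.Surjective κ ∧ x = y ∘ κ := by
  have hbij : Function.Bijective (κ ∘ J) := Finite.injective_iff_bijective.1 fun a b h =>
    hinj _ hJ (hκ _ _ h)
  let σ := Equiv.ofBijective _ hbij
  refine ⟨(x ∘ J) ∘ σ.symm, hsymm.comp_mem hJ σ.symm, hbij.2.of_comp, ?_⟩
  funext a
  exact hκ _ _ (σ.apply_symm_apply (κ a)).symm

/-- Tuples in `containing n V` have at least `m` distinct entries, so those in `spread n V` are the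
ones with at most `m`: a finite union of sets cut out by equations between coordinates. -/
theorem isClosed_spread [T2Space X] {m n : ℕ} {V : Set (Fin m → X)}
    (hsymm : IsSymmetric V) (hinj : ∀ y ∈ V, Function.Injective y) :
    IsClosed {x : containing n V | x.1 ∈ spread n V} := by
  have : {x : containing n V | x.1 ∈ spread n V} =
      ⋃ κ : Fin n → Fin m, ⋂ (a) (b) (_ : κ a = κ b), {x | x.1 a = x.1 b} := by
    ext ⟨x, J, hJ⟩
    simp only [Set.mem_ofPred_eq, Set.mem_iUnion, Set.mem_iInter]
    constructor
    · rintro ⟨y, -, κ, -, rfl⟩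
      exact ⟨κ, fun a b h => congrArg y h⟩
    · rintro ⟨κ, hκ⟩
      obtain ⟨y, hy, hs, h⟩ := eq_comp_of_factors hsymm hinj hJ hκ
      exact ⟨y, hy, κ, hs, h⟩
  rw [this]
  refine isClosed_iUnion_of_finite fun κ => isClosed_iInter fun a => isClosed_iInter fun b =>
    isClosed_iInter fun _ => isClosed_eq ?_ ?_ <;>
  exact (continuous_apply _).comp continuous_subtype_val

/-- For `x = y ∘ κ`, repeat the paths of `s y` along `κ`. Two such presentations differ by a
permutation of `Fin m`, so equivariance of `s` removes the choice. -/
theorem HasEquivariantSectionOver.spread [T2Space X] {m n : ℕ} {V : Set (Fin m → X)}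
    (hV : IsOpen V) (hinj : ∀ y ∈ V, Function.Injective y)
    (h : HasEquivariantSectionOver V) : HasEquivariantSectionOver (spread n V) := by
  obtain ⟨s, hs, hequiv⟩ := h
  choose y hy κ hκ hx using fun x : HigherTC.spread n V => x.2
  let S : HigherTC.spread n V → MultiPath n X := fun x =>
    (s ⟨y x, hy x⟩).comp (IntervalWedge.map (κ x))
  have hS : ∀ (x : HigherTC.spread n V) (y' : V) (κ' : Fin n → Fin m),
      Function.Surjective κ' → x.1 = y'.1 ∘ κ' → S x = (s y').comp (IntervalWedge.map κ') := by
    intro x y' κ' hκ' hx'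
    -- Both maps have the fibres of `x` as their fibres, since `y x` and `y'` are injective.
    have hker : ∀ a b, κ x a = κ x b ↔ κ' a = κ' b := by
      intro a b
      rw [← (hinj _ (hy x)).eq_iff, ← (hinj _ y'.2).eq_iff]
      change (y x ∘ κ x) a = (y x ∘ κ x) b ↔ (y'.1 ∘ κ') a = (y'.1 ∘ κ') b
      rw [← hx x, ← hx']
    obtain ⟨J, hJ⟩ := (hκ x).hasRightInverse
    have hbij : Function.Bijective (κ' ∘ J) := Finite.injective_iff_bijective.1 fun a b h => by
      simpa [hJ a, hJ b] using (hker _ _).2 h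
    let σ := Equiv.ofBijective _ hbij
    have hσκ : σ ∘ κ x = κ' := funext fun a => (hker _ _).1 (hJ (κ x a))
    have hyσ : y'.1 ∘ σ = y x := by
      funext a
      obtain ⟨b, rfl⟩ := hκ x a
      change y'.1 ((σ ∘ κ x) b) = (y x ∘ κ x) b
      rw [hσκ, ← hx x, hx']
      rfl
    have hperm : permTuple σ⁻¹ y'.1 = y x := by
      rw [permTuple_eq_comp, inv_inv, hyσ]
    have hmem : permTuple σ⁻¹ y'.1 ∈ V := hperm ▸ hy x
    have hsy : s ⟨y x, hy x⟩ = permPaths σ⁻¹ (s y') := by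
      rw [← hequiv σ⁻¹ y' hmem]
      congr 1
      exact Subtype.ext hperm.symm
    change (s ⟨y x, hy x⟩).comp (IntervalWedge.map (κ x)) = _
    rw [hsy, permPaths_eq_comp_map, inv_inv, comp_map_comp_map, hσκ]
  refine ⟨⟨S, ?_⟩, ?_, ?_⟩
  · rw [continuous_iff_continuousAt]
    intro x₀
    obtain ⟨J, hJ⟩ := (hκ x₀).hasRightInverse
    have hxJ : x₀.1 ∘ J ∈ V := by
      rw [hx x₀, Function.comp_assoc, hJ.comp_eq_id, Function.comp_id]
      exact hy x₀
    -- On this neighbourhood the entry `a` can only coincide with the representative `J (κ x₀ a)`,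
    -- so the single map `κ x₀` presents every tuple.
    let T : Set (HigherTC.spread n V) := {x | x.1 ∘ J ∈ V ∧ ∀ a k, k ≠ κ x₀ a → x.1 a ≠ x.1 (J k)}
    have hTeq : T = (fun x => x.1 ∘ J) ⁻¹' V ∩
        ⋂ (a) (k) (_ : k ≠ κ x₀ a), {x | x.1 a ≠ x.1 (J k)} := by
      ext x
      simp [T]
    have hcomp : Continuous fun x : Fin n → X => x ∘ J := by fun_prop
    have hTopen : IsOpen T := by
      rw [hTeq]
      refine (hV.preimage (hcomp.comp continuous_subtype_val)).inter ?_
      refine isOpen_iInter_of_finite fun a => isOpen_iInter_of_finite fun k =>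
        isOpen_iInter_of_finite fun _ => isOpen_ne_fun ?_ ?_ <;>
      exact (continuous_apply _).comp continuous_subtype_val
    have hx₀ : x₀ ∈ T := by
      refine ⟨hxJ, fun a k hk h => hk ?_⟩
      rw [hx x₀] at h
      rw [hinj _ (hy x₀) h, hJ]
    have hfact : ∀ x ∈ T, x.1 = (x.1 ∘ J) ∘ κ x₀ := by
      rintro x ⟨hxV, hne⟩
      have hbij : Function.Bijective (κ x ∘ J) := Finite.injective_iff_bijective.1 fun a b h =>
        hinj _ hxV (by rw [hx x]; exact congrArg (y x) h)
      funext a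
      obtain ⟨k, hk⟩ := hbij.2 (κ x a)
      have hak : x.1 a = x.1 (J k) := by
        rw [hx x]
        exact congrArg (y x) hk.symm
      have : k = κ x₀ a := by_contra fun h => hne a k h hak
      rw [hak, this]
      rfl
    refine ContinuousOn.continuousAt ?_ (hTopen.mem_nhds hx₀)
    rw [continuousOn_iff_continuous_domRestrict]
    have : T.domRestrict S = fun x : T =>
        (s ⟨x.1.1 ∘ J, x.2.1⟩).comp (IntervalWedge.map (κ x₀)) :=
      funext fun x => hS x.1 ⟨_, x.2.1⟩ _ (hκ x₀) (hfact x.1 x.2)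
    rw [this]
    refine (ContinuousMap.continuous_precomp _).comp (s.continuous.comp ?_)
    exact (hcomp.comp (continuous_subtype_val.comp continuous_subtype_val)).subtype_mk _
  · intro x
    change endpoints ((s ⟨y x, hy x⟩).comp (IntervalWedge.map (κ x))) = _
    rw [endpoints_comp_map, hs]
    exact (hx x).symm
  · intro σ x h
    have := hS ⟨permTuple σ x.1, h⟩ ⟨y x, hy x⟩ (κ x ∘ (σ⁻¹ : Equiv.Perm (Fin n)))
      ((hκ x).comp (σ⁻¹).surjective) (by
        change permTuple σ x.1 = _
        rw [permTuple_eq_comp]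
        conv_lhs => rw [hx x]
        rfl)
    change S _ = permPaths σ (S x)
    rw [this, permPaths_eq_comp_map, comp_map_comp_map]

/-! ### Sections of `ε_n` and equivariant sections over configurations -/

instance (n : ℕ) : ContinuousConstSMul (Equiv.Perm (Fin n)) (ConfigSpace n X) where
  continuous_const_smul σ :=
    ((continuous_permTuple σ).comp continuous_subtype_val).subtype_mk _

instance (n : ℕ) : ContinuousConstSMul (Equiv.Perm (Fin n)) (ConfigMultiPath n X) where
  continuous_const_smul _ :=
    ((ContinuousMap.continuous_precomp _).comp continuous_subtype_val).subtype_mk _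

/-- The end points of a multipath with distinct end points, as a configuration. -/
def configEndpoints {n : ℕ} (γ : ConfigMultiPath n X) : ConfigSpace n X :=
  ⟨endpoints γ.1, γ.2⟩

theorem continuous_configEndpoints {n : ℕ} :
    Continuous (configEndpoints : ConfigMultiPath n X → ConfigSpace n X) :=
  (continuous_endpoints.comp continuous_subtype_val).subtype_mk _

theorem configEndpoints_smul {n : ℕ} (σ : Equiv.Perm (Fin n)) (γ : ConfigMultiPath n X) :
    configEndpoints (σ • γ) = σ • configEndpoints γ := rfl

/-- The class of an ordered configuration. -/
def unorder {n : ℕ} {X : Type*} (x : ConfigSpace n X) : UnorderedConfigSpace n X :=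
  Quotient.mk _ x

/-- The class of a multipath with distinct end points. -/
def unorderPaths {n : ℕ} (γ : ConfigMultiPath n X) : UnorderedMultiPath n X :=
  Quotient.mk _ γ

theorem epsilon_unorderPaths {n : ℕ} (γ : ConfigMultiPath n X) :
    epsilon n X (unorderPaths γ) = unorder (configEndpoints γ) := rfl

theorem unorder_eq_iff {n : ℕ} {X : Type*} {x y : ConfigSpace n X} :
    unorder x = unorder y ↔ ∃ σ : Equiv.Perm (Fin n), σ • y = x :=
  Quotient.eq

theorem unorderPaths_eq_iff {n : ℕ} {γ δ : ConfigMultiPath n X} :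
    unorderPaths γ = unorderPaths δ ↔ ∃ σ : Equiv.Perm (Fin n), σ • δ = γ :=
  Quotient.eq

theorem unorder_smul {n : ℕ} {X : Type*} (σ : Equiv.Perm (Fin n)) (x : ConfigSpace n X) :
    unorder (σ • x) = unorder x :=
  unorder_eq_iff.2 ⟨σ, rfl⟩

theorem unorderPaths_smul {n : ℕ} (σ : Equiv.Perm (Fin n)) (γ : ConfigMultiPath n X) :
    unorderPaths (σ • γ) = unorderPaths γ :=
  unorderPaths_eq_iff.2 ⟨σ, rfl⟩

theorem continuous_unorder {n : ℕ} : Continuous (unorder : ConfigSpace n X → _) :=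
  continuous_quotient_mk'

theorem continuous_unorderPaths {n : ℕ} : Continuous (unorderPaths : ConfigMultiPath n X → _) :=
  continuous_quotient_mk'

theorem isOpenMap_unorder {n : ℕ} : IsOpenMap (unorder : ConfigSpace n X → _) :=
  isOpenMap_quotient_mk'_mul

theorem isOpenMap_unorderPaths {n : ℕ} : IsOpenMap (unorderPaths : ConfigMultiPath n X → _) :=
  isOpenMap_quotient_mk'_mul

theorem surjective_unorder {n : ℕ} {X : Type*} :
    Function.Surjective (unorder : ConfigSpace n X → _) :=
  Quotient.mk_surjective

theorem surjective_unorderPaths {n : ℕ} :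
    Function.Surjective (unorderPaths : ConfigMultiPath n X → _) :=
  Quotient.mk_surjective

theorem eq_one_of_smul_eq {n : ℕ} {X : Type*} {σ : Equiv.Perm (Fin n)} {x : ConfigSpace n X}
    (h : σ • x = x) : σ = 1 := by
  refine inv_eq_one.1 (Equiv.ext fun i => ?_)
  exact x.2 (congrFun (congrArg Subtype.val h) i)

/-- Freeness of the action makes lifts with given ordered end points unique, which forces
equivariance of lifted sections. -/
theorem configMultiPath_ext {n : ℕ} {γ δ : ConfigMultiPath n X}
    (h : unorderPaths γ = unorderPaths δ) (he : configEndpoints γ = configEndpoints δ) :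
    γ = δ := by
  obtain ⟨σ, rfl⟩ := unorderPaths_eq_iff.1 h
  have hσ : σ = 1 := eq_one_of_smul_eq (x := configEndpoints δ) he
  rw [hσ, one_smul]

/-- Take disjoint neighbourhoods of the points of `x`: a nontrivial permutation puts some entry in
the wrong one. -/
theorem exists_open_of_smul_mem [T2Space X] {n : ℕ} (x : ConfigSpace n X) :
    ∃ O : Set (ConfigSpace n X), IsOpen O ∧ x ∈ O ∧
      ∀ (σ : Equiv.Perm (Fin n)), ∀ y ∈ O, σ • y ∈ O → σ = 1 := by
  obtain ⟨U, hU, hdisj⟩ := (Set.finite_range x.1).t2_separation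
  refine ⟨⋂ k, {y | y.1 k ∈ U (x.1 k)}, ?_, ?_, ?_⟩
  · exact isOpen_iInter_of_finite fun k =>
      (hU _).2.preimage ((continuous_apply k).comp continuous_subtype_val)
  · simpa using fun k => (hU (x.1 k)).1
  · intro σ y hy hσy
    refine inv_eq_one.1 (Equiv.ext fun k => ?_)
    have h₁ : y.1 (σ⁻¹ k) ∈ U (x.1 (σ⁻¹ k)) := Set.mem_iInter.1 hy _
    have h₂ : y.1 (σ⁻¹ k) ∈ U (x.1 k) := Set.mem_iInter.1 hσy k
    by_contra hne
    exact Set.disjoint_left.1 (hdisj ⟨_, rfl⟩ ⟨_, rfl⟩ (x.2.ne hne)) h₁ h₂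

/-- The ordered configurations whose class lies in `U`. -/
def orderedPreimage {n : ℕ} {X : Type*} (U : Set (UnorderedConfigSpace n X)) : Set (Fin n → X) :=
  Subtype.val '' (unorder ⁻¹' U)

theorem isOpen_orderedPreimage [T2Space X] {n : ℕ} {U : Set (UnorderedConfigSpace n X)}
    (hU : IsOpen U) : IsOpen (orderedPreimage U) :=
  isOpen_setOf_injective.isOpenMap_subtype_val _ (hU.preimage continuous_unorder)

theorem isSymmetric_orderedPreimage {n : ℕ} {X : Type*} (U : Set (UnorderedConfigSpace n X)) :
    IsSymmetric (orderedPreimage U) := by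
  rw [isSymmetric_iff]
  rintro σ _ ⟨x, hx, rfl⟩
  exact ⟨σ • x, by rwa [Set.mem_preimage, unorder_smul], rfl⟩

theorem injective_of_mem_orderedPreimage {n : ℕ} {X : Type*}
    {U : Set (UnorderedConfigSpace n X)} : ∀ x ∈ orderedPreimage U, Function.Injective x := by
  rintro _ ⟨x, -, rfl⟩
  exact x.2

/-- Lift `s (unorder x)` to the unique multipath with ordered end points `x`. -/
theorem HasSectionOver.hasEquivariantSectionOver [T2Space X] {n : ℕ}
    {U : Set (UnorderedConfigSpace n X)} (h : HasSectionOver (epsilon n X) U) :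
    HasEquivariantSectionOver (orderedPreimage U) := by
  obtain ⟨s, hs⟩ := h
  have hlift : ∀ x : unorder ⁻¹' U, ∃ γ : ConfigMultiPath n X,
      unorderPaths γ = s ⟨unorder x.1, x.2⟩ ∧ configEndpoints γ = x.1 := by
    intro x
    obtain ⟨γ, hγ⟩ := surjective_unorderPaths (s ⟨unorder x.1, x.2⟩)
    have h := hs ⟨unorder x.1, x.2⟩
    rw [← hγ, epsilon_unorderPaths] at h
    obtain ⟨σ, hσ⟩ := unorder_eq_iff.1 h.symm
    exact ⟨σ • γ, by rw [unorderPaths_smul, hγ], by rw [configEndpoints_smul, hσ]⟩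
  choose L hL₁ hL₂ using hlift
  have hLcont : Continuous L := by
    rw [continuous_iff_continuousAt]
    intro x₀ N hN
    obtain ⟨N', hN', hN'open, hmem⟩ := mem_nhds_iff.1 hN
    obtain ⟨O, hO, hxO, hfree⟩ := exists_open_of_smul_mem x₀.1
    have hM : IsOpen (N' ∩ configEndpoints ⁻¹' O) :=
      hN'open.inter (hO.preimage continuous_configEndpoints)
    let q : unorder ⁻¹' U → U := fun x => ⟨unorder x.1, x.2⟩
    have hq : Continuous q := (continuous_unorder.comp continuous_subtype_val).subtype_mk _
    have hW : IsOpen (Subtype.val ⁻¹' O ∩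
        (s ∘ q) ⁻¹' (unorderPaths '' (N' ∩ configEndpoints ⁻¹' O)) : Set (unorder ⁻¹' U)) :=
      (hO.preimage continuous_subtype_val).inter
        ((isOpenMap_unorderPaths _ hM).preimage (s.continuous.comp hq))
    -- Near `x₀` the class has a representative in `N'` with end points in `O`. It is a translate of
    -- `L x`, whose end points also lie in `O`, so it equals `L x`.
    refine Filter.mem_map.2 <| Filter.mem_of_superset (hW.mem_nhds ⟨hxO, L x₀, ⟨hmem, ?_⟩, hL₁ x₀⟩) ?_
    · rw [Set.mem_preimage, hL₂]
      exact hxO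
    · rintro x ⟨hx, γ, ⟨hγN, hγO⟩, hγ⟩
      have hγL : unorderPaths γ = unorderPaths (L x) := hγ.trans (hL₁ x).symm
      obtain ⟨σ, rfl⟩ := unorderPaths_eq_iff.1 hγL
      rw [Set.mem_preimage, configEndpoints_smul, hL₂] at hγO
      rw [hfree σ _ hx hγO, one_smul] at hγN
      exact hN' hγN
  have hconf : ∀ x : orderedPreimage U, ∃ h : Function.Injective x.1,
      (⟨x.1, h⟩ : ConfigSpace n X) ∈ unorder ⁻¹' U := by
    rintro ⟨_, x, hx, rfl⟩
    exact ⟨x.2, hx⟩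
  let c : orderedPreimage U → unorder ⁻¹' U := fun x =>
    ⟨⟨x.1, (hconf x).choose⟩, (hconf x).choose_spec⟩
  have hc : Continuous c := (continuous_subtype_val.subtype_mk _).subtype_mk _
  refine ⟨⟨fun x => (L (c x)).1, continuous_subtype_val.comp (hLcont.comp hc)⟩, ?_, ?_⟩
  · intro x
    exact congrArg Subtype.val (hL₂ (c x))
  · intro σ x h
    have hσ : (c ⟨permTuple σ x.1, h⟩).1 = σ • (c x).1 := rfl
    have : L (c ⟨permTuple σ x.1, h⟩) = σ • L (c x) := by
      apply configMultiPath_ext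
      · rw [unorderPaths_smul, hL₁, hL₁]
        congr 1
        exact Subtype.ext ((congrArg unorder hσ).trans (unorder_smul σ _))
      · rw [hL₂, configEndpoints_smul, hL₂, hσ]
    exact congrArg Subtype.val this

/-- Passage to orbits is open, hence a quotient map from the configurations in `A` onto their image;
equivariance lets the section factor through it. -/
theorem HasEquivariantSectionOver.hasSectionOver {n : ℕ} {A : Set (Fin n → X)}
    (hA : IsOpen A) (h : HasEquivariantSectionOver A) :
    IsOpen (unorder '' (Subtype.val ⁻¹' A : Set (ConfigSpace n X))) ∧
      HasSectionOver (epsilon n X) (unorder '' (Subtype.val ⁻¹' A : Set (ConfigSpace n X))) := by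
  obtain ⟨s, hs, hequiv⟩ := h
  have hAopen : IsOpen (Subtype.val ⁻¹' A : Set (ConfigSpace n X)) :=
    hA.preimage continuous_subtype_val
  refine ⟨isOpenMap_unorder _ hAopen, ?_⟩
  set A' : Set (ConfigSpace n X) := Subtype.val ⁻¹' A with hA'
  let q : A' → (unorder '' A' : Set (UnorderedConfigSpace n X)) := fun x => ⟨unorder x.1, x.1, x.2, rfl⟩
  have hq : IsQuotientMap q := by
    refine IsOpenMap.isQuotientMap ?_ ?_ ?_
    · intro W hW
      rw [isOpen_induced_iff]
      refine ⟨_, isOpenMap_unorder _ (hAopen.isOpenMap_subtype_val _ hW), ?_⟩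
      ext ⟨u, hu⟩
      constructor
      · rintro ⟨_, ⟨x, hx, rfl⟩, hxu⟩
        exact ⟨x, hx, Subtype.ext hxu⟩
      · rintro ⟨x, hx, hxu⟩
        exact ⟨x.1, ⟨x, hx, rfl⟩, congrArg Subtype.val hxu⟩
    · exact (continuous_unorder.comp continuous_subtype_val).subtype_mk _
    · rintro ⟨_, x, hx, rfl⟩
      exact ⟨⟨x, hx⟩, rfl⟩
  let S : A' → ConfigMultiPath n X := fun x =>
    ⟨s ⟨x.1.1, x.2⟩, by rw [hs]; exact x.1.2⟩
  have hS : Continuous S := (s.continuous.comp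
    ((continuous_subtype_val.comp continuous_subtype_val).subtype_mk _)).subtype_mk _
  have hinv : ∀ x y : A', q x = q y → unorderPaths (S x) = unorderPaths (S y) := by
    rintro ⟨x, hx⟩ ⟨y, hy⟩ h
    obtain ⟨σ, rfl⟩ := unorder_eq_iff.1 (congrArg Subtype.val h)
    exact unorderPaths_eq_iff.2 ⟨σ, Subtype.ext (hequiv σ ⟨y.1, hy⟩ hx).symm⟩
  let T : C(A', UnorderedMultiPath n X) := ⟨_, continuous_unorderPaths.comp hS⟩
  refine ⟨(IsQuotientMap.lift (f := ⟨q, hq.continuous⟩) hq T hinv), fun u => ?_⟩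
  obtain ⟨x, rfl⟩ := hq.surjective u
  have h₁ : (IsQuotientMap.lift (f := ⟨q, hq.continuous⟩) hq T hinv) (q x) = T x :=
    DFunLike.congr_fun (IsQuotientMap.lift_comp (f := ⟨q, hq.continuous⟩) hq T hinv) x
  rw [h₁]
  change unorder (configEndpoints (S x)) = unorder x.1
  congr 1
  exact Subtype.ext (hs _)

/-! ### Counting the sets of a covering -/

theorem leastOrTop_le {P : ℕ → Prop} {k : ℕ} (h : P k) :
    leastOrTop P ≤ ((k : ℤ) : WithTop ℤ) := by
  classical
  have hex : ∃ k, P k := ⟨k, h⟩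
  rw [leastOrTop, dif_pos hex]
  exact_mod_cast Nat.find_min' hex h

theorem exists_of_leastOrTop_ne_top {P : ℕ → Prop} (h : leastOrTop P ≠ ⊤) :
    ∃ k : ℕ, leastOrTop P = ((k : ℤ) : WithTop ℤ) ∧ P k := by
  classical
  by_cases hex : ∃ k, P k
  · exact ⟨Nat.find hex, dif_pos hex, Nat.find_spec hex⟩
  · exact absurd (dif_neg hex) h

/-- Counting sets by `m = genus + 1` treats the value `-1` uniformly, as the empty covering. -/
theorem exists_cover_of_schwarzGenus_ne_top {E B : Type*} [TopologicalSpace E]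
    [TopologicalSpace B] {p : E → B} (h : schwarzGenus p ≠ ⊤) :
    ∃ m : ℕ, schwarzGenus p = (((m : ℤ) - 1 : ℤ) : WithTop ℤ) ∧
      ∃ U : Fin m → Set B, (⋃ i, U i) = Set.univ ∧
        ∀ i, IsOpen (U i) ∧ HasSectionOver p (U i) := by
  by_cases hEB : IsEmpty E ∧ IsEmpty B
  · have := hEB.2
    refine ⟨0, ?_, fun i => i.elim0, Subsingleton.elim _ _, fun i => i.elim0⟩
    rw [schwarzGenus, if_pos hEB]
    rfl
  · rw [schwarzGenus, if_neg hEB] at h ⊢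
    obtain ⟨k, hk, hP⟩ := exists_of_leastOrTop_ne_top h
    refine ⟨k + 1, ?_, hP⟩
    rw [hk]
    simp

theorem tcSigma_le_of_option {n : ℕ} {ι : Type*} [Fintype ι]
    (A : Option ι → Set (Fin n → X)) (hcover : ∀ x, ∃ i, x ∈ A i)
    (hA : ∀ i, IsOpen (A i) ∧ IsSymmetric (A i) ∧ HasEquivariantSectionOver (A i)) :
    tcSigma n X ≤ ((Fintype.card ι : ℤ) : WithTop ℤ) := by
  refine leastOrTop_le ?_
  have e : Fin (Fintype.card ι + 1) ≃ Option ι :=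
    (finCongr Fintype.card_option.symm).trans (Fintype.equivFin _).symm
  refine ⟨A ∘ e, ?_, fun i => hA (e i)⟩
  refine Set.eq_univ_of_forall fun x => ?_
  obtain ⟨i, hi⟩ := hcover x
  exact Set.mem_iUnion.2 ⟨e.symm i, by simpa using hi⟩

/-! ### The two inequalities -/

theorem schwarzGenus_epsilon_le_tcSigma (n : ℕ) :
    schwarzGenus (epsilon n X) ≤ tcSigma n X := by
  by_cases htop : tcSigma n X = ⊤
  · rw [htop]
    exact le_top
  obtain ⟨k, hk, A, hcover, hA⟩ := exists_of_leastOrTop_ne_top htop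
  rw [tcSigma, hk, schwarzGenus]
  split_ifs
  · exact_mod_cast (by omega : (-1 : ℤ) ≤ k)
  · refine leastOrTop_le ⟨fun i => unorder '' (Subtype.val ⁻¹' A i), ?_, fun i =>
      (hA i).2.2.hasSectionOver (hA i).1⟩
    rw [← Set.image_iUnion, ← Set.preimage_iUnion, hcover, Set.preimage_univ, Set.image_univ,
      surjective_unorder.range_eq]

theorem exists_eq_comp_of_card_range {X : Type*} {n m : ℕ} (x : Fin n → X)
    (h : Nat.card (Set.range x) = m) :
    ∃ (y : Fin m → X) (κ : Fin n → Fin m),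
      Function.Injective y ∧ Function.Surjective κ ∧ x = y ∘ κ := by
  let e := Finite.equivFinOfCardEq h
  refine ⟨fun k => (e.symm k).1, fun i => e ⟨x i, i, rfl⟩,
    Subtype.val_injective.comp e.symm.injective, fun k => ?_, ?_⟩
  · obtain ⟨i, hi⟩ := (e.symm k).2
    exact ⟨i, by simp [hi]⟩
  · funext i
    simp

theorem exists_open_spread (hX : IsENR X) {m n : ℕ} {V : Set (Fin m → X)} (hV : IsOpen V)
    (hsymm : IsSymmetric V) (hinj : ∀ y ∈ V, Function.Injective y)
    (h : HasEquivariantSectionOver V) :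
    ∃ A : Set (Fin n → X), spread n V ⊆ A ∧ IsOpen A ∧ IsSymmetric A ∧
      HasEquivariantSectionOver A := by
  have := hX.metrizableSpace
  exact exists_open_extension hX (spread_subset_containing V) (isOpen_containing hV)
    (isSymmetric_spread V) (isSymmetric_containing V) (isClosed_spread hsymm hinj)
    (h.spread hV hinj)

/-- Over single points, constant paths form a section. -/
theorem hasEquivariantSectionOver_one :
    HasEquivariantSectionOver (Set.univ : Set (Fin 1 → X)) := by
  refine ⟨⟨fun x => ContinuousMap.const _ (x.1 0),
    ContinuousMap.continuous_const'.comp ((continuous_apply 0).comp continuous_subtype_val)⟩,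
    fun x => ?_, fun σ x _ => ?_⟩
  · funext i
    rw [Subsingleton.elim i 0]
    rfl
  · rw [Subsingleton.elim σ 1]
    rfl

theorem tcSigma_le (hX : IsENR X) (n : ℕ) (hn : 1 ≤ n) :
    tcSigma n X ≤ (∑ i ∈ Finset.Icc 2 n, schwarzGenus (epsilon i X)) +
      (((n : ℤ) - 1 : ℤ) : WithTop ℤ) := by
  have := hX.metrizableSpace
  by_cases htop : ∑ i ∈ Finset.Icc 2 n, schwarzGenus (epsilon i X) = ⊤
  · rw [htop, top_add]
    exact le_top
  have hfin : ∀ i : Finset.Icc 2 n, schwarzGenus (epsilon i X) ≠ ⊤ := fun i hi =>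
    htop (WithTop.sum_eq_top.2 ⟨i, i.2, hi⟩)
  choose m hm U hUcover hU using fun i => exists_cover_of_schwarzGenus_ne_top (hfin i)
  have hstrata : ∀ j : (i : Finset.Icc 2 n) × Fin (m i), ∃ A : Set (Fin n → X),
      spread n (orderedPreimage (U j.1 j.2)) ⊆ A ∧ IsOpen A ∧ IsSymmetric A ∧
        HasEquivariantSectionOver A := fun j =>
    exists_open_spread hX (isOpen_orderedPreimage (hU j.1 j.2).1)
      (isSymmetric_orderedPreimage _) injective_of_mem_orderedPreimage
      (hU j.1 j.2).2.hasEquivariantSectionOver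
  choose A hspread hA using hstrata
  obtain ⟨A₁, hspread₁, hA₁⟩ := exists_open_spread (n := n) hX isOpen_univ
    (isSymmetric_iff.2 fun _ _ _ => trivial)
    (fun _ _ => Function.injective_of_subsingleton _) (hasEquivariantSectionOver_one (X := X))
  -- `none` indexes the diagonal stratum, `some ⟨i, j⟩` the `j`-th set over the stratum with `i`
  -- distinct entries.
  have hbound := tcSigma_le_of_option (fun j => j.elim A₁ A) (fun x => ?_) (by
    rintro (_ | j)
    · exact hA₁
    · exact hA j)
  · refine hbound.trans (le_of_eq ?_)
    have hsum : ∑ i ∈ Finset.Icc 2 n, schwarzGenus (epsilon i X) =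
        ((∑ i : Finset.Icc 2 n, ((m i : ℤ) - 1) : ℤ) : WithTop ℤ) := by
      rw [← Finset.sum_coe_sort, WithTop.coe_sum]
      exact Finset.sum_congr rfl fun i _ => hm i
    rw [hsum, ← WithTop.coe_add, Fintype.card_sigma, Finset.sum_sub_distrib]
    congr 1
    simp
    omega
  -- The number `c` of distinct entries of `x` selects its stratum.
  · obtain ⟨c, hc⟩ : ∃ c, Nat.card (Set.range x) = c := ⟨_, rfl⟩
    obtain ⟨y, κ, hy, hκ, hx⟩ := exists_eq_comp_of_card_range x hc
    have hcn : c ≤ n := by simpa using Fintype.card_le_of_surjective κ hκ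
    have hc₁ : 1 ≤ c := Fin.pos (κ ⟨0, hn⟩)
    rcases hc₁.eq_or_lt with rfl | hc₂
    · exact ⟨none, hspread₁ ⟨y, trivial, κ, hκ, hx⟩⟩
    · let i : Finset.Icc 2 n := ⟨c, Finset.mem_Icc.2 ⟨hc₂, hcn⟩⟩
      have hmem : unorder (⟨y, hy⟩ : ConfigSpace c X) ∈ ⋃ j, U i j := hUcover i ▸ Set.mem_univ _
      obtain ⟨j, hj⟩ := Set.mem_iUnion.1 hmem
      exact ⟨some ⟨i, j⟩, hspread ⟨i, j⟩ ⟨y, ⟨⟨y, hy⟩, hj, rfl⟩, κ, hκ, hx⟩⟩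

end HigherTC

theorem mainTheorem12 {X : Type*} [TopologicalSpace X] (hX : HigherTC.IsENR X)
    (n : ℕ) (hn : 1 ≤ n) :
    HigherTC.schwarzGenus (HigherTC.epsilon n X) ≤ HigherTC.tcSigma n X ∧
    HigherTC.tcSigma n X ≤
      (∑ i ∈ Finset.Icc 2 n, HigherTC.schwarzGenus (HigherTC.epsilon i X)) +
        (((n : ℤ) - 1 : ℤ) : WithTop ℤ) :=
  ⟨HigherTC.schwarzGenus_epsilon_le_tcSigma n, HigherTC.tcSigma_le hX n hn⟩
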